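/- Identify $\mathbb{S}^3$ with the unit quaternions, equip $\mathbb{H}$ with $\langle x,y\rangle=\mathrm{Re}(x\overline{y})$, and let ${\rm U}\mathbb{S}^3=\{(x,y)\in\mathbb{H}^2 : |x|=|y|=1,\ \langle x,y\rangle=0\}$. At $(x,y)\in{\rm U}\mathbb{S}^3$ let $W_{(x,y)}$ be the set of pairs $(\xi,\mu)\in\mathbb{H}^2$ with $\xi,\mu\perp x,y$. On it, set $Az=y\overline{x}z$, $\omega_i((\xi,\mu),(\xi',\mu'))=\langle\xi,\mu'\rangle-\langle\mu,\xi'\rangle$, $J(\xi,\mu)=(-A\mu,A\xi)$ and $\omega_k=\omega_i(\cdot,J\cdot)$. A smooth immersion $\phi:\mathbb{R}^2\to{\rm U}\mathbb{S}^3$ is bilegendrian if its tangent planes lie in $W$ and $\phi^*\omega_i=\phi^*\omega_k=0$. It is doubly-periodic if it has two linearly independent periods. Let $\phi$ be a smooth doubly-periodic bilegendrian immersion with factorization $(a,b,\gamma_1,\gamma_2)$. That is, $a,b$ are orthogonal unit quaternions, $\gamma_1,\gamma_2:\mathbb{R}\to\mathbb{S}^3$ are smooth and parametrized by arc length, with $\gamma_1(0)=\gamma_2(0)=1$,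 $\dot\gamma_1\perp\overline{a}b\,\gamma_1$ and $\dot\gamma_2\perp\gamma_2\,a\overline{b}$, and $$\phi(x_1,x_2)=\big(\gamma_2(x_2)\,a\,\gamma_1(x_1),\ \gamma_2(x_2)\,b\,\gamma_1(x_1)\big)\qquad\text{for all }x_1,x_2 .$$ For $q,p\in\mathbb{R}$, say that $\gamma_1$ is $q$-quasiperiodic with period $p$ if $\gamma_1(x+p)=e^{2\pi q\,\overline{a}b}\,\gamma_1(x)$ for all $x$, and that $\gamma_2$ is $q$-quasiperiodic with period $p$ if $\gamma_2(x+p)=\gamma_2(x)\,e^{2\pi q\,a\overline{b}}$ for all $x$. Call them $q$-quasiperiodic if this holds for some $p\neq0$, and periodic if they have a period $p\neq0$. Theorem. If the first component $\mathbb{R}^2\to\mathbb{S}^3$ of $\phi$ is also an immersion, then each of $\gamma_1$ and $\gamma_2$ is either periodic or $\tfrac12$-quasiperiodic. More precisely, whenever $\gamma_i$ is $q$-quasiperiodic with period $p$ for some real numbers $q$ and $p$, it is, with that same $p$, either $p$-periodic or $\tfrac12$-quasiperiodic with period $p$. -/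

import Mathlib

/-!
Quaternions carry the inner product `inner ℝ x y = re (x * star y)`.  The sphere `S³` is the set of
unit quaternions, and `US³` its unit tangent bundle, both seen inside quaternionic space.
-/

open scoped ContDiff

namespace BilegendrianS3

/-- The unit tangent bundle of `S³`: pairs of orthogonal unit quaternions. -/
def UnitTangentS3 : Set (Quaternion ℝ × Quaternion ℝ) :=
  {m | ‖m.1‖ = 1 ∧ ‖m.2‖ = 1 ∧ inner ℝ m.1 m.2 = 0}

/-- The fibre at `m = (x, y)` of the contact bundle `W` of `US³`: pairs `(ξ, μ)` of vectors, both of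
which are orthogonal to `x` and to `y`. -/
def contactFibre (m : Quaternion ℝ × Quaternion ℝ) : Set (Quaternion ℝ × Quaternion ℝ) :=
  {v | inner ℝ v.1 m.1 = 0 ∧ inner ℝ v.1 m.2 = 0 ∧ inner ℝ v.2 m.1 = 0 ∧ inner ℝ v.2 m.2 = 0}

/-- The rotation `A z = y x̄ z` by `π/2` of the plane orthogonal to `x` and `y`, where `m = (x, y)`. -/
noncomputable def rotA (m : Quaternion ℝ × Quaternion ℝ) (z : Quaternion ℝ) : Quaternion ℝ :=
  m.2 * star m.1 * z

/-- The symplectic form `ω_i ((ξ, μ), (ξ', μ')) = ⟨ξ, μ'⟩ - ⟨μ, ξ'⟩`. -/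
noncomputable def omegaI (v w : Quaternion ℝ × Quaternion ℝ) : ℝ :=
  inner ℝ v.1 w.2 - inner ℝ v.2 w.1

/-- The pseudo-involution `J (ξ, μ) = (-A μ, A ξ)` of the contact fibre at `m`. -/
noncomputable def invJ (m v : Quaternion ℝ × Quaternion ℝ) : Quaternion ℝ × Quaternion ℝ :=
  (-rotA m v.2, rotA m v.1)

/-- The symplectic form `ω_k = ω_i (·, J ·)` of the contact fibre at `m`. -/
noncomputable def omegaK (m v w : Quaternion ℝ × Quaternion ℝ) : ℝ :=
  omegaI v (invJ m w)

/-- A smooth immersion of the plane into a normed space. -/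
def IsSmoothImmersion {E : Type*} [NormedAddCommGroup E] [NormedSpace ℝ E] (f : ℝ × ℝ → E) : Prop :=
  ContDiff ℝ ∞ f ∧ ∀ z, Function.Injective (fderiv ℝ f z)

/-- Smooth bilegendrian immersions of the plane in `US³`: immersions tangent to the contact bundle
along which both `ω_i` and `ω_k` vanish. -/
structure IsBilegendrianImmersion (φ : ℝ × ℝ → Quaternion ℝ × Quaternion ℝ) : Prop where
  immersion : IsSmoothImmersion φ
  mem_unitTangent : ∀ z, φ z ∈ UnitTangentS3
  tangent_contact : ∀ z u, fderiv ℝ φ z u ∈ contactFibre (φ z)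
  omegaI_eq_zero : ∀ z u v, omegaI (fderiv ℝ φ z u) (fderiv ℝ φ z v) = 0
  omegaK_eq_zero : ∀ z u v, omegaK (φ z) (fderiv ℝ φ z u) (fderiv ℝ φ z v) = 0

/-- A function on the plane is doubly periodic if it has two linearly independent periods. -/
def IsDoublyPeriodic {E : Type*} (f : ℝ × ℝ → E) : Prop :=
  ∃ w : Fin 2 → ℝ × ℝ, LinearIndependent ℝ w ∧ ∀ i, Function.Periodic f (w i)

/-- A smooth arc-length parametrized curve in `S³`. -/
structure IsArcLengthCurve (γ : ℝ → Quaternion ℝ) : Prop where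
  smooth : ContDiff ℝ ∞ γ
  norm_eq_one : ∀ t, ‖γ t‖ = 1
  norm_deriv_eq_one : ∀ t, ‖deriv γ t‖ = 1

/-- Left `ξ`-horizontal: the velocity is orthogonal to the left translate `x ↦ x * ξ` of `ξ`. -/
def IsLeftHorizontal (ξ : Quaternion ℝ) (γ : ℝ → Quaternion ℝ) : Prop :=
  ∀ t, inner ℝ (deriv γ t) (γ t * ξ) = 0

/-- Right `ξ`-horizontal: the velocity is orthogonal to the right translate `x ↦ ξ * x` of `ξ`. -/
def IsRightHorizontal (ξ : Quaternion ℝ) (γ : ℝ → Quaternion ℝ) : Prop :=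
  ∀ t, inner ℝ (deriv γ t) (ξ * γ t) = 0

/-- `(a, b, γ₁, γ₂)` is the factorization of `φ`. The vector `a * star b` is, up to sign, `b * star a`,
and `φ (x₁, x₂) = (γ₂ x₂ * a * γ₁ x₁, γ₂ x₂ * b * γ₁ x₁)`. -/
structure IsFactorization (φ : ℝ × ℝ → Quaternion ℝ × Quaternion ℝ) (a b : Quaternion ℝ)
    (γ₁ γ₂ : ℝ → Quaternion ℝ) : Prop where
  norm_a : ‖a‖ = 1
  norm_b : ‖b‖ = 1
  orthogonal : inner ℝ a b = 0
  arcLength₁ : IsArcLengthCurve γ₁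
  arcLength₂ : IsArcLengthCurve γ₂
  horizontal₁ : IsRightHorizontal (star a * b) γ₁
  horizontal₂ : IsLeftHorizontal (a * star b) γ₂
  start₁ : γ₁ 0 = 1
  start₂ : γ₂ 0 = 1
  eq : ∀ x₁ x₂ : ℝ, φ (x₁, x₂) = (γ₂ x₂ * a * γ₁ x₁, γ₂ x₂ * b * γ₁ x₁)

/-- Left `ξ`-horizontal curves: `q`-quasiperiodicity with given period `p`. -/
def IsLeftQuasiperiodicWith (ξ : Quaternion ℝ) (q p : ℝ) (γ : ℝ → Quaternion ℝ) : Prop :=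
  ∀ x, γ (x + p) = γ x * NormedSpace.exp ((2 * Real.pi * q) • ξ)

/-- Right `ξ`-horizontal curves: `q`-quasiperiodicity with given period `p`. -/
def IsRightQuasiperiodicWith (ξ : Quaternion ℝ) (q p : ℝ) (γ : ℝ → Quaternion ℝ) : Prop :=
  ∀ x, γ (x + p) = NormedSpace.exp ((2 * Real.pi * q) • ξ) * γ x

/-- Left `ξ`-horizontal curves: `q`-quasiperiodicity. The trivial period `0` is excluded. -/
def IsLeftQuasiperiodic (ξ : Quaternion ℝ) (q : ℝ) (γ : ℝ → Quaternion ℝ) : Prop :=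
  ∃ p : ℝ, p ≠ 0 ∧ IsLeftQuasiperiodicWith ξ q p γ

/-- Right `ξ`-horizontal curves: `q`-quasiperiodicity. The trivial period `0` is excluded. -/
def IsRightQuasiperiodic (ξ : Quaternion ℝ) (q : ℝ) (γ : ℝ → Quaternion ℝ) : Prop :=
  ∃ p : ℝ, p ≠ 0 ∧ IsRightQuasiperiodicWith ξ q p γ

/-- A periodic curve, with a non-zero period. -/
def IsPeriodicCurve (γ : ℝ → Quaternion ℝ) : Prop :=
  ∃ p : ℝ, p ≠ 0 ∧ Function.Periodic γ p

end BilegendrianS3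

open scoped Quaternion

namespace BilegendrianS3

/-! Put `ξ = star a * b`. A period of `φ` multiplies `γ₁` on the left by a unit quaternion `c`;
comparing both components of `φ` shows that `c` commutes with `ξ`, so `c = s + t ξ` with `s² + t² =
1`. The right-trivialized velocity `u = γ₁' * star γ₁` lies in the plane orthogonal to `1` and `ξ`,
and translation by the period conjugates it by `c`, a rotation of that plane.

The first component being an immersion means that `u` is never parallel to the fixed vector `v =
star a * γ₂'(0) * a` of the same plane. So `G = ⟨u, ξ v⟩` keeps one sign, while `G (x + p) + G (x -
p) = 2 (s² - t²) G x`. A function of constant sign can satisfy this only if `2 ≤ 2 (s² - t²)`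
(`two_le_of_ne_zero_of_recurrence`); hence `t = 0` and `c = ±1` (`eq_zero_of_translate_eq`).
Quaternion conjugation reduces `γ₂` to this case. -/

/-! ### Sign-preserving solutions of a three-term recurrence -/

lemma exists_nat_mul_lt_neg {D : ℝ} (hD : D < 0) (g : ℝ) : ∃ n : ℕ, g + n * D < 0 := by
  obtain ⟨n, hn⟩ := exists_nat_gt (g / -D)
  rw [div_lt_iff₀ (by linarith)] at hn
  exact ⟨n, by linarith⟩

/-- The forward differences of a positive function with non-positive second differences are
non-negative. -/
lemma le_shift_of_concave {G : ℝ → ℝ} {p k : ℝ} (hpos : ∀ x, 0 < G x) (hk : k ≤ 2)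
    (hG : ∀ x, G (x + p) + G (x - p) = k * G x) (x : ℝ) : G x ≤ G (x + p) := by
  by_contra! h
  obtain ⟨n, hn⟩ := exists_nat_mul_lt_neg (sub_neg.mpr h) (G x)
  -- The second difference is `(k - 2) * G ≤ 0`, so differences never exceed the first, negative
  -- one, and `G` falls below a decreasing line.
  have key : ∀ m : ℕ, G (x + (m + 1) * p) - G (x + m * p) ≤ G (x + p) - G x ∧
      G (x + m * p) ≤ G x + m * (G (x + p) - G x) := by
    intro m
    induction m with
    | zero => simp
    | succ m ih =>
      have h1 := hG (x + (m + 1) * p)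
      have e1 : x + (m + 1) * p + p = x + ((m : ℝ) + 1 + 1) * p := by ring
      have e2 : x + (m + 1) * p - p = x + m * p := by ring
      rw [e1, e2] at h1
      have h2 := hpos (x + (m + 1) * p)
      push_cast
      constructor
      · nlinarith [ih.1]
      · linarith [ih.1, ih.2]
  linarith [(key n).2, hpos (x + n * p)]

/-- A positive solution of `G (x + p) + G (x - p) = k * G x` has `2 ≤ k`. -/
lemma two_le_of_pos_of_recurrence {G : ℝ → ℝ} {p k : ℝ} (hpos : ∀ x, 0 < G x)
    (hG : ∀ x, G (x + p) + G (x - p) = k * G x) : 2 ≤ k := by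
  by_contra! hk
  have h1 := le_shift_of_concave hpos hk.le hG 0
  -- The recurrence is symmetric in `p` and `-p`. Both bounds together give `2 * G 0 ≤ k * G 0`.
  have h2 := le_shift_of_concave (p := -p) hpos hk.le
    (fun x => by rw [← hG x, add_comm, sub_neg_eq_add, sub_eq_add_neg]) 0
  have h3 := hG 0
  rw [← sub_eq_add_neg] at h2
  nlinarith [hpos 0]

/-- A continuous nowhere vanishing solution of `G (x + p) + G (x - p) = k * G x` has `2 ≤ k`. -/
lemma two_le_of_ne_zero_of_recurrence {G : ℝ → ℝ} {p k : ℝ} (hc : Continuous G)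
    (hne : ∀ x, G x ≠ 0) (hG : ∀ x, G (x + p) + G (x - p) = k * G x) : 2 ≤ k := by
  rcases lt_or_gt_of_ne (hne 0) with h0 | h0
  · refine two_le_of_pos_of_recurrence (G := fun x => -G x) (p := p) (fun x => ?_)
      (fun x => by linarith [hG x])
    by_contra! hx
    obtain ⟨y, hy⟩ := mem_range_of_exists_le_of_exists_ge hc ⟨0, h0.le⟩
      ⟨x, neg_nonpos.mp hx⟩
    exact hne y hy
  · refine two_le_of_pos_of_recurrence (p := p) (fun x => ?_) hG
    by_contra! hx
    obtain ⟨y, hy⟩ := mem_range_of_exists_le_of_exists_ge hc ⟨x, hx⟩ ⟨0, h0.le⟩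
    exact hne y hy

/-! ### Quaternion algebra around an imaginary unit -/

lemma mul_star_self_of_norm_eq_one {q : ℍ[ℝ]} (h : ‖q‖ = 1) : q * star q = 1 := by
  rw [Quaternion.self_mul_star, Quaternion.normSq_eq_norm_mul_self, h]; simp

lemma star_mul_self_of_norm_eq_one {q : ℍ[ℝ]} (h : ‖q‖ = 1) : star q * q = 1 := by
  rw [Quaternion.star_mul_self, Quaternion.normSq_eq_norm_mul_self, h]; simp

lemma star_eq_neg_of_re_eq_zero {q : ℍ[ℝ]} (h : q.re = 0) : star q = -q := by
  ext <;> simp [h]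

lemma mul_self_of_re_eq_zero {q : ℍ[ℝ]} (h : q.re = 0) :
    q * q = -((‖q‖ ^ 2 : ℝ) : ℍ[ℝ]) := by
  have := Quaternion.self_mul_star q
  rw [star_eq_neg_of_re_eq_zero h, Quaternion.normSq_eq_norm_mul_self] at this
  rw [sq, ← this]; simp

lemma anticommute_of_orthogonal {u ξ : ℍ[ℝ]} (hu : u.re = 0) (hξ : ξ.re = 0)
    (h : inner ℝ u ξ = 0) : ξ * u = -(u * ξ) := by
  rw [Quaternion.inner_def] at h
  simp [hu, hξ] at h
  ext <;> simp [hu, hξ] <;> linarith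

/-- The centralizer of an imaginary unit `ξ` is spanned by `1` and `ξ`. -/
lemma eq_add_smul_of_commute {c ξ : ℍ[ℝ]} (hξ : ξ.re = 0) (hn : ‖ξ‖ = 1)
    (hc : c * ξ = ξ * c) : c = (c.re : ℍ[ℝ]) + (inner ℝ c ξ : ℝ) • ξ := by
  have h1 : ξ.imI ^ 2 + ξ.imJ ^ 2 + ξ.imK ^ 2 = 1 := by
    have := Quaternion.normSq_eq_norm_mul_self ξ
    rw [hn, Quaternion.normSq_def'] at this
    simpa [hξ] using this
  have hI := congrArg (fun q : ℍ[ℝ] => q.imI) hc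
  have hJ := congrArg (fun q : ℍ[ℝ] => q.imJ) hc
  have hK := congrArg (fun q : ℍ[ℝ] => q.imK) hc
  simp [hξ] at hI hJ hK
  rw [Quaternion.inner_def]
  -- Commuting means that the cross product of the imaginary parts vanishes; the coefficients below
  -- expand `ξ × (c × ξ) = |ξ|² c - ⟨c, ξ⟩ ξ`.
  ext
  · simp [hξ]
  · simp [hξ]
    linear_combination (-c.imI) * h1 - ξ.imK / 2 * hJ + ξ.imJ / 2 * hK
  · simp [hξ]
    linear_combination (-c.imJ) * h1 + ξ.imK / 2 * hI - ξ.imI / 2 * hK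
  · simp [hξ]
    linear_combination (-c.imK) * h1 - ξ.imJ / 2 * hI + ξ.imI / 2 * hJ

lemma re_mul_comm (x y : ℍ[ℝ]) : (x * y).re = (y * x).re := by
  simp; ring

/-- In the plane orthogonal to `1` and `ξ`, vectors orthogonal to `ξ * v` are multiples of `v`. -/
lemma exists_eq_smul_of_inner_eq_zero {u v ξ : ℍ[ℝ]} (hξ : ξ.re = 0) (hn : ‖ξ‖ = 1)
    (hu : u.re = 0) (hv : v.re = 0) (huξ : inner ℝ u ξ = 0) (hvξ : inner ℝ v ξ = 0)
    (hv0 : v ≠ 0) (h : inner ℝ u (ξ * v) = 0) : ∃ s : ℝ, u = s • v := by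
  have au := anticommute_of_orthogonal hu hξ huξ
  have av := anticommute_of_orthogonal hv hξ hvξ
  -- Both factors anticommute with `ξ`, so `u * v` commutes with it. Its `ξ`-part is `⟨u, ξ v⟩` up
  -- to sign, so `u * v` is real; multiplying by `v` isolates `u`.
  have hc : (u * v) * ξ = ξ * (u * v) := by
    have : v * ξ = -(ξ * v) := by rw [av, neg_neg]
    rw [mul_assoc, this, mul_neg, ← mul_assoc, ← mul_assoc, au, neg_mul]
  have e := eq_add_smul_of_commute hξ hn hc
  have h0 : inner ℝ (u * v) ξ = 0 := by
    rw [Quaternion.inner_def, star_mul, star_eq_neg_of_re_eq_zero hv,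
      star_eq_neg_of_re_eq_zero hξ] at h
    rw [Quaternion.inner_def, star_eq_neg_of_re_eq_zero hξ]
    rw [neg_mul_neg, ← mul_assoc] at h
    rw [mul_neg, Quaternion.re_neg, h, neg_zero]
  rw [h0, zero_smul, add_zero] at e
  have e2 : u * (v * v) = ((u * v).re : ℍ[ℝ]) * v := by rw [← mul_assoc, ← e]
  rw [mul_self_of_re_eq_zero hv, mul_neg, Quaternion.mul_coe_eq_smul,
    Quaternion.coe_mul_eq_smul] at e2
  refine ⟨-((u * v).re / ‖v‖ ^ 2), ?_⟩
  have hne : ‖v‖ ^ 2 ≠ 0 := by simpa using hv0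
  rw [neg_smul, div_eq_inv_mul, mul_smul, ← e2, smul_neg, neg_neg, smul_smul,
    inv_mul_cancel₀ hne, one_smul]

/-- Conjugation by `s + t ξ` and by its inverse, summed up on a vector orthogonal to `1`
and `ξ`. -/
lemma conj_add_conj {u ξ : ℍ[ℝ]} (hξ : ξ.re = 0) (hn : ‖ξ‖ = 1) (hu : u.re = 0)
    (huξ : inner ℝ u ξ = 0) (s t : ℝ) :
    ((s : ℍ[ℝ]) + t • ξ) * u * star ((s : ℍ[ℝ]) + t • ξ)
      + star ((s : ℍ[ℝ]) + t • ξ) * u * ((s : ℍ[ℝ]) + t • ξ) = (2 * (s ^ 2 - t ^ 2)) • u := by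
  have au := anticommute_of_orthogonal hu hξ huξ
  have hξξ : ξ * ξ = -1 := by rw [mul_self_of_re_eq_zero hξ, hn]; simp
  -- The terms in `s * t` have opposite signs in the two conjugates and cancel in the sum.
  have h1 : ξ * u * ξ = u := by rw [au, neg_mul, mul_assoc, hξξ]; simp
  have hs : star ((s : ℍ[ℝ]) + t • ξ) = (s : ℍ[ℝ]) - t • ξ := by
    rw [star_add, Quaternion.star_coe, Quaternion.star_smul, star_eq_neg_of_re_eq_zero hξ,
      smul_neg, sub_eq_add_neg]
  rw [hs]
  have hsm : (s : ℍ[ℝ]) = s • 1 := by ext <;> simp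
  rw [hsm]
  simp only [add_mul, mul_add, sub_mul, mul_sub, smul_mul_assoc, mul_smul_comm, one_mul, mul_one,
    smul_smul, h1, smul_add, smul_sub]
  module

/-! ### Translations of horizontal curves -/

lemma inner_deriv_self_eq_zero {γ : ℝ → ℍ[ℝ]} (hγ : IsArcLengthCurve γ) (x : ℝ) :
    inner ℝ (deriv γ x) (γ x) = 0 := by
  have hd : HasDerivAt γ (deriv γ x) x :=
    (hγ.smooth.differentiable (by simp)).differentiableAt.hasDerivAt
  have h1 := hd.inner ℝ hd
  have h2 : (fun t => inner ℝ (γ t) (γ t)) = fun _ => (1 : ℝ) := by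
    funext t; rw [real_inner_self_eq_norm_sq, hγ.norm_eq_one]; norm_num
  rw [h2] at h1
  have h3 := h1.unique (hasDerivAt_const x (1 : ℝ))
  rw [real_inner_comm] at h3
  linarith

/-- If a right horizontal curve picks up the factor `s + t ξ` under a translation and its
right-trivialized velocity is never parallel to a fixed vector `v` orthogonal to `1` and `ξ`,
then `t = 0`. -/
theorem eq_zero_of_translate_eq {γ : ℝ → ℍ[ℝ]} {ξ v : ℍ[ℝ]} {s t p : ℝ}
    (hγ : IsArcLengthCurve γ) (hξ : ξ.re = 0) (hn : ‖ξ‖ = 1) (hh : IsRightHorizontal ξ γ)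
    (hv : v.re = 0) (hvξ : inner ℝ v ξ = 0) (hv0 : v ≠ 0)
    (hpar : ∀ x, ∀ k : ℝ, deriv γ x ≠ k • (v * γ x)) (hst : s ^ 2 + t ^ 2 = 1)
    (hp : ∀ x, γ (x + p) = ((s : ℍ[ℝ]) + t • ξ) * γ x) : t = 0 := by
  set c : ℍ[ℝ] := (s : ℍ[ℝ]) + t • ξ with hc
  have hcd : ∀ x, deriv γ (x + p) = c * deriv γ x := by
    intro x
    have hd : HasDerivAt γ (deriv γ x) x :=
      (hγ.smooth.differentiable (by simp)).differentiableAt.hasDerivAt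
    rw [← deriv_comp_add_const, show (fun x => γ (x + p)) = fun x => c * γ x from funext hp]
    exact (hd.const_mul c).deriv
  have hcn : ‖c‖ = 1 := by
    have h := congrArg norm (hp 0)
    rwa [norm_mul, hγ.norm_eq_one, hγ.norm_eq_one, mul_one, eq_comm] at h
  let u : ℝ → ℍ[ℝ] := fun x => deriv γ x * star (γ x)
  have huγ : ∀ x, u x * γ x = deriv γ x := fun x => by
    simp only [u]; rw [mul_assoc, star_mul_self_of_norm_eq_one (hγ.norm_eq_one x), mul_one]
  have hu : ∀ x, (u x).re = 0 := fun x => by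
    rw [← Quaternion.inner_def]; exact inner_deriv_self_eq_zero hγ x
  have huξ : ∀ x, inner ℝ (u x) ξ = 0 := fun x => by
    have := hh x
    rwa [Quaternion.inner_def, star_mul, ← mul_assoc, ← Quaternion.inner_def] at this
  have hup : ∀ x, u (x + p) = c * u x * star c := fun x => by
    simp only [u]; rw [hcd, hp, star_mul]; noncomm_ring
  have hum : ∀ x, u (x - p) = star c * u x * c := fun x => by
    have h := hup (x - p)
    rw [sub_add_cancel] at h
    rw [h]
    calc u (x - p) = (star c * c) * u (x - p) * (star c * c) := by
          rw [star_mul_self_of_norm_eq_one hcn]; simp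
      _ = _ := by noncomm_ring
  have hcont : Continuous fun x => inner ℝ (u x) (ξ * v) := by
    have h1 : Continuous (deriv γ) := hγ.smooth.continuous_deriv (by simp)
    have h2 : Continuous γ := hγ.smooth.continuous
    exact ((h1.mul h2.star).inner continuous_const)
  have key := two_le_of_ne_zero_of_recurrence (k := 2 * (s ^ 2 - t ^ 2)) (p := p) hcont
    (fun x h0 => by
      obtain ⟨k, hk⟩ := exists_eq_smul_of_inner_eq_zero hξ hn (hu x) hv (huξ x) hvξ hv0 h0
      refine hpar x k ?_
      rw [← huγ x, hk, smul_mul_assoc])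
    (fun x => by
      rw [← inner_add_left, hup, hum, conj_add_conj hξ hn (hu x) (huξ x), real_inner_smul_left])
  have : t ^ 2 ≤ 0 := by linarith
  exact pow_eq_zero_iff (two_ne_zero) |>.mp (le_antisymm this (sq_nonneg t))

lemma norm_sq_coe_add_smul {ξ : ℍ[ℝ]} (hξ : ξ.re = 0) (hn : ‖ξ‖ = 1) (s t : ℝ) :
    ‖(s : ℍ[ℝ]) + t • ξ‖ ^ 2 = s ^ 2 + t ^ 2 := by
  have h1 : ξ.imI ^ 2 + ξ.imJ ^ 2 + ξ.imK ^ 2 = 1 := by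
    have := Quaternion.normSq_eq_norm_mul_self ξ
    rw [hn, Quaternion.normSq_def'] at this
    simpa [hξ] using this
  rw [sq ‖_‖, ← Quaternion.normSq_eq_norm_mul_self, Quaternion.normSq_def']
  simp [hξ]
  linear_combination t ^ 2 * h1

lemma exp_smul_eq {ξ : ℍ[ℝ]} (hξ : ξ.re = 0) (hn : ‖ξ‖ = 1) (θ : ℝ) :
    NormedSpace.exp (θ • ξ) = ((Real.cos θ : ℝ) : ℍ[ℝ]) + Real.sin θ • ξ := by
  rw [Quaternion.exp_of_re_eq_zero _ (by simp [hξ]), norm_smul, hn, mul_one, Real.norm_eq_abs,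
    Real.cos_abs, smul_smul]
  congr 2
  -- The quaternion exponential is expressed through the norm `|θ|`; evenness of `sin θ / θ` removes
  -- the absolute value.
  rcases abs_cases θ with ⟨h, _⟩ | ⟨h, _⟩ <;> rw [h]
  · rcases eq_or_ne θ 0 with rfl | h0
    · simp
    · field_simp
  · have h0 : θ ≠ 0 := by rintro rfl; simp_all
    rw [Real.sin_neg]; field_simp

lemma exp_half_turn {ξ : ℍ[ℝ]} (hξ : ξ.re = 0) (hn : ‖ξ‖ = 1) :
    NormedSpace.exp ((2 * Real.pi * (1 / 2)) • ξ) = -1 := by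
  rw [exp_smul_eq hξ hn, show 2 * Real.pi * (1 / 2) = Real.pi by ring]
  simp

/-- Under the assumptions of `eq_zero_of_translate_eq`, a translation that multiplies the curve by
an element of the centralizer of `ξ` multiplies it by `1` or by `-1 = exp (π ξ)`. -/
theorem periodic_or_half_quasiperiodic {γ : ℝ → ℍ[ℝ]} {ξ v c : ℍ[ℝ]} {p : ℝ}
    (hγ : IsArcLengthCurve γ) (hξ : ξ.re = 0) (hn : ‖ξ‖ = 1) (hh : IsRightHorizontal ξ γ)
    (hv : v.re = 0) (hvξ : inner ℝ v ξ = 0) (hv0 : v ≠ 0)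
    (hpar : ∀ x, ∀ k : ℝ, deriv γ x ≠ k • (v * γ x)) (hc : c * ξ = ξ * c)
    (hp : ∀ x, γ (x + p) = c * γ x) :
    Function.Periodic γ p ∨ IsRightQuasiperiodicWith ξ (1 / 2) p γ := by
  have hcn : ‖c‖ = 1 := by
    have h := congrArg norm (hp 0)
    rwa [norm_mul, hγ.norm_eq_one, hγ.norm_eq_one, mul_one, eq_comm] at h
  have e := eq_add_smul_of_commute hξ hn hc
  have hst : c.re ^ 2 + inner ℝ c ξ ^ 2 = 1 := by
    rw [← norm_sq_coe_add_smul hξ hn, ← e, hcn, one_pow]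
  have h0 := eq_zero_of_translate_eq hγ hξ hn hh hv hvξ hv0 hpar hst (fun x => by rw [← e, hp])
  rw [h0] at hst e
  rw [zero_smul, add_zero] at e
  rw [zero_pow two_ne_zero, add_zero] at hst
  rcases sq_eq_sq_iff_eq_or_eq_neg.mp (hst.trans (one_pow 2).symm) with h | h
  · left
    intro x
    rw [hp, e, h]; simp
  · right
    intro x
    rw [exp_half_turn hξ hn, hp, e, h]; simp

/-! ### Conjugation symmetry and the immersion condition -/

instance : StarModule ℝ ℍ[ℝ] where
  star_smul r q := by rw [Quaternion.star_smul, star_trivial r]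

lemma IsArcLengthCurve.star {γ : ℝ → ℍ[ℝ]} (hγ : IsArcLengthCurve γ) :
    IsArcLengthCurve fun t => star (γ t) where
  smooth := ((starL' ℝ : ℍ[ℝ] ≃L[ℝ] ℍ[ℝ]) : ℍ[ℝ] →L[ℝ] ℍ[ℝ]).contDiff.comp hγ.smooth
  norm_eq_one t := by rw [norm_star, hγ.norm_eq_one]
  norm_deriv_eq_one t := by rw [deriv.star, norm_star, hγ.norm_deriv_eq_one]

lemma inner_star_star (x y : ℍ[ℝ]) : inner ℝ (star x) (star y) = inner ℝ x y := by
  rw [Quaternion.inner_def, Quaternion.inner_def, star_star, re_mul_comm, ← Quaternion.re_star,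
    star_mul, star_star]

/-- Conjugation is an isometry reversing products, so it carries the statement for `γ₂` to the one
for right horizontal curves. -/
lemma IsLeftHorizontal.star {γ : ℝ → ℍ[ℝ]} {ξ : ℍ[ℝ]} (h : IsLeftHorizontal ξ γ) :
    IsRightHorizontal (star ξ) fun t => star (γ t) := fun t => by
  rw [deriv.star, ← star_mul, inner_star_star]
  exact h t

lemma exp_smul_commute (ξ : ℍ[ℝ]) (θ : ℝ) :
    NormedSpace.exp (θ • ξ) * ξ = ξ * NormedSpace.exp (θ • ξ) :=
  ((Commute.refl ξ).smul_left θ).exp_left.eq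

/-- In a surface `f (x₁, x₂) = γ₂ x₂ * a * γ₁ x₁` that is an immersion, the partial derivatives are
never parallel. -/
lemma partial_ne_smul_partial {f : ℝ × ℝ → ℍ[ℝ]} {a : ℍ[ℝ]} {γ₁ γ₂ : ℝ → ℍ[ℝ]}
    (hf : IsSmoothImmersion f) (h : ∀ x₁ x₂, f (x₁, x₂) = γ₂ x₂ * a * γ₁ x₁)
    (h₁ : Differentiable ℝ γ₁) (h₂ : Differentiable ℝ γ₂) (x₁ x₂ k l : ℝ) (hkl : (k, l) ≠ 0) :
    k • (γ₂ x₂ * a * deriv γ₁ x₁) + l • (deriv γ₂ x₂ * a * γ₁ x₁) ≠ 0 := by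
  have hF : HasFDerivAt f (fderiv ℝ f (x₁, x₂)) (x₁, x₂) :=
    (hf.1.differentiable (by simp)).differentiableAt.hasFDerivAt
  have e1 : fderiv ℝ f (x₁, x₂) (1, 0) = γ₂ x₂ * a * deriv γ₁ x₁ := by
    have hc := hF.comp_hasDerivAt x₁ ((hasDerivAt_id x₁).prodMk (hasDerivAt_const x₁ x₂))
    have hd := (h₁ x₁).hasDerivAt.const_mul (γ₂ x₂ * a)
    refine hc.unique (hd.congr_of_eventuallyEq (Filter.Eventually.of_forall fun y => ?_))
    exact h y x₂
  have e2 : fderiv ℝ f (x₁, x₂) (0, 1) = deriv γ₂ x₂ * a * γ₁ x₁ := by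
    have hc := hF.comp_hasDerivAt x₂ ((hasDerivAt_const x₂ x₁).prodMk (hasDerivAt_id x₂))
    have hd := ((h₂ x₂).hasDerivAt.mul_const a).mul_const (γ₁ x₁)
    refine hc.unique (hd.congr_of_eventuallyEq (Filter.Eventually.of_forall fun y => ?_))
    exact h x₁ y
  rw [← e1, ← e2, ← map_smul, ← map_smul, ← map_add]
  intro h0
  refine hkl (hf.2 (x₁, x₂) ?_)
  rw [map_zero, ← h0]
  congr 1
  simp

/-! ### Application to the two factor curves -/

section Factorization

variable {φ : ℝ × ℝ → ℍ[ℝ] × ℍ[ℝ]} {a b : ℍ[ℝ]} {γ₁ γ₂ : ℝ → ℍ[ℝ]}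

namespace IsFactorization

lemma re_star_mul (h : IsFactorization φ a b γ₁ γ₂) : (star a * b).re = 0 := by
  rw [re_mul_comm, ← Quaternion.inner_def, real_inner_comm, h.orthogonal]

lemma re_mul_star (h : IsFactorization φ a b γ₁ γ₂) : (a * star b).re = 0 := by
  rw [← Quaternion.inner_def, h.orthogonal]

lemma norm_star_mul (h : IsFactorization φ a b γ₁ γ₂) : ‖star a * b‖ = 1 := by
  rw [norm_mul, norm_star, h.norm_a, h.norm_b, mul_one]

lemma norm_mul_star (h : IsFactorization φ a b γ₁ γ₂) : ‖a * star b‖ = 1 := by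
  rw [norm_mul, norm_star, h.norm_a, h.norm_b, mul_one]

lemma re_deriv_zero₁ (h : IsFactorization φ a b γ₁ γ₂) : (deriv γ₁ 0).re = 0 := by
  have := inner_deriv_self_eq_zero h.arcLength₁ 0
  rwa [h.start₁, Quaternion.inner_def, star_one, mul_one] at this

lemma re_deriv_zero₂ (h : IsFactorization φ a b γ₁ γ₂) : (deriv γ₂ 0).re = 0 := by
  have := inner_deriv_self_eq_zero h.arcLength₂ 0
  rwa [h.start₂, Quaternion.inner_def, star_one, mul_one] at this

/-- A translation that multiplies `γ₁` by an element of the centralizer of `star a * b`. -/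
theorem translate₁ (h : IsFactorization φ a b γ₁ γ₂)
    (himm : IsSmoothImmersion fun z => (φ z).1) {p : ℝ} {c : ℍ[ℝ]}
    (hc : c * (star a * b) = star a * b * c) (hp : ∀ x, γ₁ (x + p) = c * γ₁ x) :
    Function.Periodic γ₁ p ∨ IsRightQuasiperiodicWith (star a * b) (1 / 2) p γ₁ := by
  have ha := mul_star_self_of_norm_eq_one h.norm_a
  -- At `x₂ = 0` the partial derivatives are `a * γ₁'` and `γ₂'(0) * a * γ₁`; multiplying by `star
  -- a` turns the second into `v * γ₁`.
  refine periodic_or_half_quasiperiodic (v := star a * deriv γ₂ 0 * a) h.arcLength₁ h.re_star_mul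
    h.norm_star_mul h.horizontal₁ ?_ ?_ ?_ ?_ hc hp
  · rw [re_mul_comm, ← mul_assoc, ha, one_mul, h.re_deriv_zero₂]
  · have h0 := h.horizontal₂ 0
    rw [h.start₂, one_mul, Quaternion.inner_def, star_mul, star_star] at h0
    rw [← inner_star_star, Quaternion.inner_def, star_star, star_mul, star_mul, star_star,
      star_eq_neg_of_re_eq_zero h.re_deriv_zero₂]
    have e : star a * (-deriv γ₂ 0 * a) * (star a * b)
        = -(star a * (deriv γ₂ 0 * (a * star a) * b)) := by noncomm_ring
    rw [e, ha, mul_one, Quaternion.re_neg, re_mul_comm, mul_assoc, h0, neg_zero]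
  · rw [← norm_ne_zero_iff, norm_mul, norm_mul, norm_star, h.norm_a, h.arcLength₂.norm_deriv_eq_one]
    norm_num
  · intro x k hk
    have := partial_ne_smul_partial himm (fun x₁ x₂ => congrArg Prod.fst (h.eq x₁ x₂))
      (h.arcLength₁.smooth.differentiable (by simp)) (h.arcLength₂.smooth.differentiable (by simp))
      x 0 1 (-k) (by simp)
    refine this ?_
    rw [hk, h.start₂, one_mul, one_smul, mul_smul_comm, ← mul_assoc, ← mul_assoc, ← mul_assoc, ha,
      one_mul, neg_smul, add_neg_cancel]

/-- A translation that multiplies `γ₂` by an element of the centralizer of `a * star b`. -/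
theorem translate₂ (h : IsFactorization φ a b γ₁ γ₂)
    (himm : IsSmoothImmersion fun z => (φ z).1) {p : ℝ} {c : ℍ[ℝ]}
    (hc : c * (a * star b) = a * star b * c) (hp : ∀ x, γ₂ (x + p) = γ₂ x * c) :
    Function.Periodic γ₂ p ∨ IsLeftQuasiperiodicWith (a * star b) (1 / 2) p γ₂ := by
  have ha := star_mul_self_of_norm_eq_one h.norm_a
  have hre : (star (a * star b)).re = 0 := by rw [Quaternion.re_star, h.re_mul_star]
  have key := periodic_or_half_quasiperiodic (γ := fun t => star (γ₂ t)) (p := p) (c := star c)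
    (v := star (a * deriv γ₁ 0 * star a)) (ξ := star (a * star b)) h.arcLength₂.star hre
    (by rw [norm_star, h.norm_mul_star]) h.horizontal₂.star ?_ ?_ ?_ ?_
    (by rw [← star_mul, ← hc, star_mul]) (fun x => by rw [hp, star_mul])
  · refine key.imp (fun hk x => star_injective (hk x)) (fun hk x => star_injective ?_)
    refine (hk x).trans ?_
    rw [exp_half_turn hre (by rw [norm_star, h.norm_mul_star]), star_mul,
      exp_half_turn h.re_mul_star h.norm_mul_star, star_neg, star_one]
  · rw [Quaternion.re_star, re_mul_comm, ← mul_assoc, ha, one_mul, h.re_deriv_zero₁]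
  · have h0 := h.horizontal₁ 0
    rw [h.start₁, mul_one, Quaternion.inner_def, star_mul, star_star] at h0
    rw [inner_star_star, Quaternion.inner_def, star_mul, star_star]
    have e : a * deriv γ₁ 0 * star a * (b * star a) = a * (deriv γ₁ 0 * (star a * b) * star a) := by
      noncomm_ring
    have e1 : star b * a = -(star a * b) := by
      rw [← star_eq_neg_of_re_eq_zero h.re_star_mul, star_mul, star_star]
    rw [e1, mul_neg, Quaternion.re_neg, neg_eq_zero] at h0
    rw [e, re_mul_comm, mul_assoc, ha, mul_one, h0]
  · rw [← norm_ne_zero_iff, norm_star, norm_mul, norm_mul, norm_star, h.norm_a,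
      h.arcLength₁.norm_deriv_eq_one]
    norm_num
  · intro x k hk
    have := partial_ne_smul_partial himm (fun x₁ x₂ => congrArg Prod.fst (h.eq x₁ x₂))
      (h.arcLength₁.smooth.differentiable (by simp)) (h.arcLength₂.smooth.differentiable (by simp))
      0 x (-k) 1 (by simp)
    refine this ?_
    rw [deriv.star, ← star_mul, ← Quaternion.star_smul] at hk
    have e : γ₂ x * (a * deriv γ₁ 0 * star a) * a = γ₂ x * a * deriv γ₁ 0 * (star a * a) := by
      noncomm_ring
    rw [star_injective hk, h.start₁, mul_one, one_smul, smul_mul_assoc, e, ha, mul_one, neg_smul,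
      neg_add_cancel]

/-- A period `w` of `φ` multiplies `γ₁` by an element of the centralizer of `star a * b` under
translation by `w.1`. -/
theorem exists_translate₁ (h : IsFactorization φ a b γ₁ γ₂) {w : ℝ × ℝ}
    (hw : Function.Periodic φ w) :
    ∃ c : ℍ[ℝ], c * (star a * b) = star a * b * c ∧ ∀ x, γ₁ (x + w.1) = c * γ₁ x := by
  have ha := mul_star_self_of_norm_eq_one h.norm_a
  have ha' := star_mul_self_of_norm_eq_one h.norm_a
  have hb := mul_star_self_of_norm_eq_one h.norm_b
  have hb' := star_mul_self_of_norm_eq_one h.norm_b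
  have hg := star_mul_self_of_norm_eq_one (h.arcLength₂.norm_eq_one w.2)
  have key : ∀ x, γ₂ w.2 * a * γ₁ (x + w.1) = a * γ₁ x ∧ γ₂ w.2 * b * γ₁ (x + w.1) = b * γ₁ x := by
    intro x
    have := hw (x, 0)
    rw [show (x, (0 : ℝ)) + w = (x + w.1, w.2) by ext <;> simp, h.eq, h.eq, h.start₂, one_mul,
      one_mul] at this
    exact Prod.ext_iff.mp this
  have solve : ∀ d : ℍ[ℝ], star d * d = 1 → ∀ x, γ₂ w.2 * d * γ₁ (x + w.1) = d * γ₁ x →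
      γ₁ (x + w.1) = star d * star (γ₂ w.2) * d * γ₁ x := by
    intro d hd x hx
    rw [mul_assoc _ d, ← hx]
    calc γ₁ (x + w.1) = star d * d * γ₁ (x + w.1) := by rw [hd, one_mul]
      _ = star d * (star (γ₂ w.2) * γ₂ w.2) * d * γ₁ (x + w.1) := by rw [hg, mul_one]
      _ = _ := by noncomm_ring
  refine ⟨star a * star (γ₂ w.2) * a, ?_, fun x => solve a ha' x (key x).1⟩
  -- Each component of `φ` determines the factor, and `γ₁ 0 = 1` forces the two values to agree.
  -- This equality is what makes the factor commute with `star a * b`.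
  have e : star a * star (γ₂ w.2) * a = star b * star (γ₂ w.2) * b := by
    have h1 := solve a ha' 0 (key 0).1
    rw [solve b hb' 0 (key 0).2, h.start₁, mul_one, mul_one] at h1
    exact h1.symm
  calc star a * star (γ₂ w.2) * a * (star a * b)
      = star a * star (γ₂ w.2) * (a * star a) * b := by noncomm_ring
    _ = star a * (b * star b) * star (γ₂ w.2) * b := by rw [ha, hb, mul_one, mul_one]
    _ = star a * b * (star b * star (γ₂ w.2) * b) := by noncomm_ring
    _ = _ := by rw [← e]

/-- A period `w` of `φ` multiplies `γ₂` by an element of the centralizer of `a * star b` under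
translation by `w.2`. -/
theorem exists_translate₂ (h : IsFactorization φ a b γ₁ γ₂) {w : ℝ × ℝ}
    (hw : Function.Periodic φ w) :
    ∃ c : ℍ[ℝ], c * (a * star b) = a * star b * c ∧ ∀ x, γ₂ (x + w.2) = γ₂ x * c := by
  have ha := mul_star_self_of_norm_eq_one h.norm_a
  have ha' := star_mul_self_of_norm_eq_one h.norm_a
  have hb := mul_star_self_of_norm_eq_one h.norm_b
  have hb' := star_mul_self_of_norm_eq_one h.norm_b
  have hg := mul_star_self_of_norm_eq_one (h.arcLength₁.norm_eq_one w.1)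
  have key : ∀ x, γ₂ (x + w.2) * a * γ₁ w.1 = γ₂ x * a ∧ γ₂ (x + w.2) * b * γ₁ w.1 = γ₂ x * b := by
    intro x
    have := hw (0, x)
    rw [show ((0 : ℝ), x) + w = (w.1, x + w.2) by ext <;> simp, h.eq, h.eq, h.start₁, mul_one,
      mul_one] at this
    exact Prod.ext_iff.mp this
  have solve : ∀ d : ℍ[ℝ], d * star d = 1 → ∀ x, γ₂ (x + w.2) * d * γ₁ w.1 = γ₂ x * d →
      γ₂ (x + w.2) = γ₂ x * (d * star (γ₁ w.1) * star d) := by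
    intro d hd x hx
    rw [← mul_assoc, ← mul_assoc, ← hx]
    calc γ₂ (x + w.2) = γ₂ (x + w.2) * (d * star d) := by rw [hd, mul_one]
      _ = γ₂ (x + w.2) * d * (γ₁ w.1 * star (γ₁ w.1)) * star d := by
        rw [hg, mul_one, mul_assoc]
      _ = _ := by noncomm_ring
  refine ⟨a * star (γ₁ w.1) * star a, ?_, fun x => solve a ha x (key x).1⟩
  have e : a * star (γ₁ w.1) * star a = b * star (γ₁ w.1) * star b := by
    have h1 := solve a ha 0 (key 0).1
    rw [solve b hb 0 (key 0).2, h.start₂, one_mul, one_mul] at h1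
    exact h1.symm
  calc a * star (γ₁ w.1) * star a * (a * star b)
      = a * star (γ₁ w.1) * (star a * a) * star b := by noncomm_ring
    _ = a * (star b * b) * star (γ₁ w.1) * star b := by rw [ha', hb', mul_one, mul_one]
    _ = a * star b * (b * star (γ₁ w.1) * star b) := by noncomm_ring
    _ = _ := by rw [← e]

end IsFactorization

end Factorization

lemma exists_fst_ne_zero {w : Fin 2 → ℝ × ℝ} (hw : LinearIndependent ℝ w) :
    ∃ i, (w i).1 ≠ 0 := by
  by_contra! h
  -- With both first coordinates zero, these coefficients give a vanishing combination.
  have h2 := Fintype.linearIndependent_iff.mp hw ![(w 1).2, -(w 0).2]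
    (by ext <;> simp [h, mul_comm])
  exact hw.ne_zero 0 (Prod.ext (h 0) (by simpa using h2 1))

lemma exists_snd_ne_zero {w : Fin 2 → ℝ × ℝ} (hw : LinearIndependent ℝ w) :
    ∃ i, (w i).2 ≠ 0 := by
  by_contra! h
  have h2 := Fintype.linearIndependent_iff.mp hw ![(w 1).1, -(w 0).1]
    (by ext <;> simp [h, mul_comm])
  exact hw.ne_zero 0 (Prod.ext (by simpa using h2 1) (h 0))

end BilegendrianS3

theorem mainTheorem7
    (φ : ℝ × ℝ → Quaternion ℝ × Quaternion ℝ)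
    (hφ : BilegendrianS3.IsBilegendrianImmersion φ)
    (hper : BilegendrianS3.IsDoublyPeriodic φ)
    (a b : Quaternion ℝ) (γ₁ γ₂ : ℝ → Quaternion ℝ)
    (hfac : BilegendrianS3.IsFactorization φ a b γ₁ γ₂)
    (himm : BilegendrianS3.IsSmoothImmersion (fun z => (φ z).1)) :
    ((BilegendrianS3.IsPeriodicCurve γ₁ ∨
        BilegendrianS3.IsRightQuasiperiodic (star a * b) (1 / 2) γ₁) ∧
      (BilegendrianS3.IsPeriodicCurve γ₂ ∨
        BilegendrianS3.IsLeftQuasiperiodic (a * star b) (1 / 2) γ₂)) ∧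
    (∀ q p : ℝ, BilegendrianS3.IsRightQuasiperiodicWith (star a * b) q p γ₁ →
      Function.Periodic γ₁ p ∨
        BilegendrianS3.IsRightQuasiperiodicWith (star a * b) (1 / 2) p γ₁) ∧
    (∀ q p : ℝ, BilegendrianS3.IsLeftQuasiperiodicWith (a * star b) q p γ₂ →
      Function.Periodic γ₂ p ∨
        BilegendrianS3.IsLeftQuasiperiodicWith (a * star b) (1 / 2) p γ₂) := by
  obtain ⟨w, hw, hwp⟩ := hper
  refine ⟨⟨?_, ?_⟩, fun q p h => hfac.translate₁ himm (BilegendrianS3.exp_smul_commute _ _) h,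
    fun q p h => hfac.translate₂ himm (BilegendrianS3.exp_smul_commute _ _) h⟩
  · obtain ⟨i, hi⟩ := BilegendrianS3.exists_fst_ne_zero hw
    obtain ⟨c, hc, hx⟩ := hfac.exists_translate₁ (hwp i)
    exact (hfac.translate₁ himm hc hx).imp (fun h => ⟨_, hi, h⟩) (fun h => ⟨_, hi, h⟩)
  · obtain ⟨i, hi⟩ := BilegendrianS3.exists_snd_ne_zero hw
    obtain ⟨c, hc, hx⟩ := hfac.exists_translate₂ (hwp i)
    exact (hfac.translate₂ himm hc hx).imp (fun h => ⟨_, hi, h⟩) (fun h => ⟨_, hi, h⟩)
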